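/- Let $\mathbf T=\mathbf R\cup\{-\infty\}$ be the tropical semifield, with $a\oplus b=\max\{a,b\}$ and $a\odot b=a+b$. For an integer $n\ge 0$, let $\overline{\mathbf T[X_1,\dots,X_n]}$ be the quotient of the semiring of tropical polynomials $\mathbf T[X_1,\dots,X_n]$ by the congruence identifying two polynomials that have the same value at every point of $\mathbf T^n$, and let $\overline{\mathbf T(X_1,\dots,X_n)}$ (the tropical rational function semifield) be its semifield of fractions; its zero element is written $-\infty$, and its elements different from $-\infty$ define real-valued functions on $\mathbf R^n$. For $V\subset\mathbf R^n$, let $\mathbf E(V)$ be the congruence on $\overline{\mathbf T(X_1,\dots,X_n)}$ consisting of all pairs $(f,g)$ such that $f(x)=g(x)$ for all $x\in V$. A congruence is finitely generated if it is the smallest congruence containing some finite set of pairs. Let $\overline{V}$ denote the closure of $V$ in the usual topology of $\mathbf R^n$. Let $V\subset\mathbf R^n$ and $W\subset\mathbf R^m$ be arbitrary subsets. (1) Let $\psi:\overline{\mathbf T(X_1,\dots,X_n)}/\mathbf E(V)\to\overline{\mathbf T(Y_1,\dots,Y_m)}/\mathbf E(W)$ be a $\mathbf T$-algebra homomorphism.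 For each $i=1,\dots,n$ fix an element $f_i\in\overline{\mathbf T(Y_1,\dots,Y_m)}\setminus\{-\infty\}$ whose class modulo $\mathbf E(W)$ is the image under $\psi$ of the class of $X_i$ modulo $\mathbf E(V)$, and let $\theta:\mathbf R^m\to\mathbf R^n$, $y\mapsto(f_1(y),\dots,f_n(y))$. If $\psi$ is injective, $\theta(\overline{W})$ is closed in $\mathbf R^n$ and $\mathbf E(W)$ is finitely generated, then $\mathbf E(V)$ is finitely generated. (2) In particular, if $\overline{\mathbf T(X_1,\dots,X_n)}/\mathbf E(V)$ and $\overline{\mathbf T(Y_1,\dots,Y_m)}/\mathbf E(W)$ are isomorphic as $\mathbf T$-algebras, then $\mathbf E(V)$ is finitely generated if and only if $\mathbf E(W)$ is finitely generated. -/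

import Mathlib

noncomputable section

/-- The (max-plus) tropical semifield `ℝ ∪ {-∞}`: Mathlib's min-plus construction applied to the
reals with the reversed order.  Thus `+` is the maximum, `*` is the usual sum, `0` is `-∞` and `1`
is the real number zero. -/
abbrev TropReal : Type := Tropical (WithTop ℝᵒᵈ)

namespace TropReal

/-- The inclusion of the reals into the tropical semifield. -/
def ofReal (r : ℝ) : TropReal := Tropical.trop ((OrderDual.toDual r : ℝᵒᵈ) : WithTop ℝᵒᵈ)

/-- The real number underlying a tropical number different from `-∞`. -/
def toReal (t : TropReal) (ht : t ≠ 0) : ℝ :=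
  OrderDual.ofDual ((Tropical.untrop t).untop fun h => ht (Tropical.untrop_injective h))

theorem ofReal_toReal (t : TropReal) (ht : t ≠ 0) : ofReal (toReal t ht) = t := by
  apply Tropical.untrop_injective
  simp [ofReal, toReal]

theorem ofReal_ne_zero (r : ℝ) : ofReal r ≠ 0 := Tropical.trop_coe_ne_zero _

theorem isUnit_of_ne_zero {t : TropReal} (ht : t ≠ 0) : IsUnit t := by
  rw [← ofReal_toReal t ht]
  refine IsUnit.of_mul_eq_one (ofReal (-toReal t ht)) ?_
  apply Tropical.untrop_injective
  rw [ofReal, ofReal, Tropical.untrop_mul, Tropical.untrop_trop, Tropical.untrop_trop,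
    ← WithTop.coe_add, ← toDual_add, add_neg_cancel]
  rfl

end TropReal

/-- The congruence on `S` of all pairs on which every homomorphism `φ x`, `x ∈ V`, agrees. -/
def agreeCon {ι S R : Type*} [Semiring S] [Semiring R] (φ : ι → S →+* R) (V : Set ι) :
    RingCon S where
  r f g := ∀ x ∈ V, φ x f = φ x g
  iseqv :=
    { refl := fun _ _ _ => rfl
      symm := fun h x hx => (h x hx).symm
      trans := fun h k x hx => (h x hx).trans (k x hx) }
  mul' h k x hx := by rw [map_mul, map_mul, h x hx, k x hx]
  add' h k x hx := by rw [map_add, map_add, h x hx, k x hx]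

/-- A congruence is finitely generated if it is the smallest congruence containing some finite set
of pairs. -/
def RingCon.FinitelyGenerated {S : Type*} [Add S] [Mul S] (E : RingCon S) : Prop :=
  ∃ s : Finset (S × S), ringConGen (fun x y => (x, y) ∈ s) = E

/-- The tropical polynomial function semiring in `n` variables: tropical polynomials modulo the
congruence of having the same value at every point of `(ℝ ∪ {-∞})ⁿ`. -/
abbrev TropPolyFun (n : ℕ) : Type :=
  (agreeCon (fun x : Fin n → TropReal => (MvPolynomial.eval x : _ →+* TropReal))
    Set.univ).Quotient

/-- The tropical rational function semifield in `n` variables: the semiring of fractions of the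
tropical polynomial function semiring, in which all non-zero-divisors (that is, all nonzero
elements) are inverted. -/
def TropRatFun (n : ℕ) : Type := Localization (nonZeroDivisors (TropPolyFun n))

instance (n : ℕ) : CommSemiring (TropRatFun n) :=
  inferInstanceAs (CommSemiring (Localization (nonZeroDivisors (TropPolyFun n))))

instance (n : ℕ) : Algebra (TropPolyFun n) (TropRatFun n) :=
  inferInstanceAs (Algebra (TropPolyFun n) (Localization (nonZeroDivisors (TropPolyFun n))))

instance (n : ℕ) : Algebra TropReal (TropRatFun n) :=
  inferInstanceAs (Algebra TropReal (Localization (nonZeroDivisors (TropPolyFun n))))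

instance (n : ℕ) : IsScalarTower TropReal (TropPolyFun n) (TropRatFun n) :=
  inferInstanceAs
    (IsScalarTower TropReal (TropPolyFun n) (Localization (nonZeroDivisors (TropPolyFun n))))

instance (n : ℕ) : IsLocalization (nonZeroDivisors (TropPolyFun n)) (TropRatFun n) :=
  inferInstanceAs (IsLocalization (nonZeroDivisors (TropPolyFun n))
    (Localization (nonZeroDivisors (TropPolyFun n))))

namespace TropPolyFun

variable {n : ℕ}

/-- The value of a tropical polynomial function at a point. -/
def eval (x : Fin n → TropReal) : TropPolyFun n →+* TropReal :=
  RingCon.lift _ (MvPolynomial.eval x) fun _ _ h => h x (Set.mem_univ x)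

theorem eq_zero_of_eval_eq_zero {x : Fin n → TropReal} (hx : ∀ i, x i ≠ 0) {p : TropPolyFun n}
    (hp : eval x p = 0) : p = 0 := by
  obtain ⟨q, rfl⟩ := RingCon.mk'_surjective _ p
  have hq : MvPolynomial.eval x q = 0 := hp
  suffices q = 0 by rw [this, map_zero]
  ext d
  by_contra hd
  rw [MvPolynomial.coeff_zero] at hd
  rw [MvPolynomial.eval_eq, ← Finset.add_sum_erase _ _ (MvPolynomial.mem_support_iff.2 hd),
    Tropical.add_eq_zero_iff] at hq
  refine absurd hq.1 (mul_ne_zero hd (Finset.prod_ne_zero_iff.2 fun i _ => ?_))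
  exact pow_ne_zero _ (hx i)

theorem isUnit_eval {x : Fin n → TropReal} (hx : ∀ i, x i ≠ 0)
    (s : nonZeroDivisors (TropPolyFun n)) : IsUnit (eval x (s : TropPolyFun n)) := by
  refine TropReal.isUnit_of_ne_zero fun h => ?_
  have h0 : (s : TropPolyFun n) = 0 := eq_zero_of_eval_eq_zero hx h
  have h1 : (1 : TropPolyFun n) = 0 :=
    (mem_nonZeroDivisors_iff.1 s.2).1 1 (by rw [h0, zero_mul])
  have h2 := congrArg (eval x) h1
  rw [map_one, map_zero] at h2
  exact one_ne_zero h2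

end TropPolyFun

namespace TropRatFun

variable {n m : ℕ}

/-- The tropical rational function given by the `i`-th variable. -/
def X (i : Fin n) : TropRatFun n :=
  algebraMap (TropPolyFun n) (TropRatFun n) (RingCon.mk' _ (MvPolynomial.X i))

/-- The value of a tropical rational function at a point of `ℝⁿ`; the value of a fraction `p / q`
is `p(x) - q(x)`. -/
def eval (x : Fin n → ℝ) : TropRatFun n →+* TropReal :=
  IsLocalization.lift (M := nonZeroDivisors (TropPolyFun n))
    (g := TropPolyFun.eval fun i => TropReal.ofReal (x i))
    (TropPolyFun.isUnit_eval fun i => TropReal.ofReal_ne_zero (x i))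

theorem eval_ne_zero {f : TropRatFun n} (hf : f ≠ 0) (x : Fin n → ℝ) : eval x f ≠ 0 := by
  intro h
  obtain ⟨p, s, rfl⟩ := IsLocalization.exists_mk'_eq (nonZeroDivisors (TropPolyFun n)) f
  rw [eval, IsLocalization.lift_mk'_spec, mul_zero] at h
  apply hf
  rw [TropPolyFun.eq_zero_of_eval_eq_zero (fun i => TropReal.ofReal_ne_zero (x i)) h,
    IsLocalization.mk'_zero]

/-- The congruence `E(V)` on the tropical rational function semifield associated with a subset `V`
of `ℝⁿ`: all pairs of tropical rational functions that agree at every point of `V`. -/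
def E (V : Set (Fin n → ℝ)) : RingCon (TropRatFun n) := agreeCon eval V

/-- The map `ℝᵐ → ℝⁿ`, `y ↦ (f₁(y), …, fₙ(y))`, given by tropical rational functions different
from `-∞`. -/
def toMap (f : Fin n → TropRatFun m) (hf : ∀ i, f i ≠ 0) (y : Fin m → ℝ) : Fin n → ℝ :=
  fun i => TropReal.toReal (eval y (f i)) (eval_ne_zero (hf i) y)

end TropRatFun

end

/-! Let `s` be a finite set of generators of `E W` and `Z` the set of points of `ℝᵐ` where all pairs
in `s` agree. Then `E W = E Z`. At points of `W`, `ψ` is composition with `θ = toMap f hf`, so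
injectivity gives `E V = E (θ '' Z)` (`finitelyGenerated_of_injective`).

Tropical rational functions are piecewise affine with integer slopes, so `Z` and the graph of `θ`
are finite unions of polyhedra. By Fourier–Motzkin elimination so is the projection `θ '' Z`
(`isIntPolyhedral_image_toMap`).

It remains to see that `E S` is finitely generated for such a union `S` (`E_finitelyGenerated`). If
`S` is nonempty, Hoffman's bound gives a rational function `F ≥ 0` vanishing on `S` with `dist(x, S)
≤ C * F x`. Two functions agreeing on `S` are Lipschitz, hence differ by at most `k * F` for some
natural number `k`. This is a tropical inequality, from which the single relation `F ~ 1` (the real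
number zero) identifies them. -/

section TropicalCongruences

open Set

/-- Affine functions with integer slopes on `ι → ℝ`: the slopes and the constant term. -/
abbrev IntAffine (ι : Type*) : Type _ := (ι → ℤ) × ℝ

/-! ### Affine functions with integer slopes, Fourier–Motzkin elimination, Hoffman's bound. -/

namespace IntAffine

variable {ι : Type*}

section Eval

variable [Fintype ι]

/-- The value of an affine function at a point. -/
def ev (a : IntAffine ι) (x : ι → ℝ) : ℝ := ∑ i, (a.1 i : ℝ) * x i + a.2

theorem ev_add (a b : IntAffine ι) (x : ι → ℝ) : (a + b).ev x = a.ev x + b.ev x := by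
  simp only [ev, Prod.fst_add, Prod.snd_add, Pi.add_apply, Int.cast_add, add_mul,
    Finset.sum_add_distrib]
  ring

theorem ev_neg (a : IntAffine ι) (x : ι → ℝ) : (-a).ev x = -a.ev x := by
  simp only [ev, Prod.fst_neg, Prod.snd_neg, Pi.neg_apply, Int.cast_neg, neg_mul,
    Finset.sum_neg_distrib]
  ring

theorem ev_sub (a b : IntAffine ι) (x : ι → ℝ) : (a - b).ev x = a.ev x - b.ev x := by
  rw [sub_eq_add_neg, ev_add, ev_neg, sub_eq_add_neg]

theorem ev_zsmul (k : ℤ) (a : IntAffine ι) (x : ι → ℝ) : (k • a).ev x = k * a.ev x := by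
  simp only [ev, Prod.smul_fst, Prod.smul_snd, Pi.smul_apply, smul_eq_mul, Int.cast_mul]
  rw [zsmul_eq_mul, mul_add, Finset.mul_sum]
  simp only [mul_assoc]

theorem ev_const (c : ℝ) (x : ι → ℝ) : ev (0, c) x = c := by simp [ev]

theorem ev_single [DecidableEq ι] (i : ι) (x : ι → ℝ) :
    ev (Pi.single i 1, 0) x = x i := by
  simp [ev, Pi.single_apply]

theorem ev_add_single [DecidableEq ι] (a : IntAffine ι) (x : ι → ℝ) (i : ι) (t : ℝ) :
    a.ev (x + Pi.single i t) = a.ev x + a.1 i * t := by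
  simp only [ev, Pi.add_apply, mul_add, Finset.sum_add_distrib, Pi.single_apply, mul_ite, mul_zero,
    Finset.sum_ite_eq', Finset.mem_univ, if_true]
  ring

/-- The metric is the sup metric, so the Lipschitz constant is the `ℓ¹` norm of the slopes. -/
theorem ev_le_add_dist (a : IntAffine ι) (x y : ι → ℝ) :
    a.ev x ≤ a.ev y + (∑ i, |(a.1 i : ℝ)|) * dist x y := by
  have h : a.ev x - a.ev y = ∑ i, (a.1 i : ℝ) * (x i - y i) := by
    simp only [ev, mul_sub, Finset.sum_sub_distrib]
    ring
  have h' : ∑ i, (a.1 i : ℝ) * (x i - y i) ≤ (∑ i, |(a.1 i : ℝ)|) * dist x y := by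
    rw [Finset.sum_mul]
    refine Finset.sum_le_sum fun i _ => (le_abs_self _).trans ?_
    rw [abs_mul]
    gcongr
    exact dist_le_pi_dist x y i
  linarith

/-- The polyhedron on which all affine functions in a set are nonpositive. -/
def polyhedron (s : Set (IntAffine ι)) : Set (ι → ℝ) := {x | ∀ a ∈ s, a.ev x ≤ 0}

end Eval

/-- The inequalities obtained from `s` by Fourier–Motzkin elimination of the `i`-th variable. -/
def eliminate (i : ι) (s : Set (IntAffine ι)) : Set (IntAffine ι) :=
  {a ∈ s | a.1 i = 0} ∪
    -- Cross-multiplying by the positive weights, instead of dividing, keeps the slopes integral.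
    image2 (fun a b => (-a.1 i) • b + b.1 i • a) {a ∈ s | a.1 i < 0} {b ∈ s | 0 < b.1 i}

theorem finite_eliminate (i : ι) {s : Set (IntAffine ι)} (hs : s.Finite) :
    (eliminate i s).Finite :=
  (hs.subset (sep_subset _ _)).union
    ((hs.subset (sep_subset _ _)).image2 _ (hs.subset (sep_subset _ _)))

theorem eliminate_apply_self {i : ι} {s : Set (IntAffine ι)} {a : IntAffine ι}
    (ha : a ∈ eliminate i s) : a.1 i = 0 := by
  rcases ha with ha | ⟨a, -, b, -, rfl⟩
  · exact ha.2
  · simp [mul_comm]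

theorem eliminate_apply_eq_zero {i j : ι} {s : Set (IntAffine ι)} (hs : ∀ a ∈ s, a.1 j = 0)
    {a : IntAffine ι} (ha : a ∈ eliminate i s) : a.1 j = 0 := by
  rcases ha with ha | ⟨a, ha, b, hb, rfl⟩
  · exact hs a ha.1
  · simp [hs a ha.1, hs b hb.1]

variable [Fintype ι]

theorem exists_between_of_finite {A B : Set ℝ} (hA : A.Finite) (hA' : A.Nonempty)
    (h : ∀ a ∈ A, ∀ b ∈ B, a ≤ b) : ∃ t, (∀ a ∈ A, a ≤ t) ∧ ∀ b ∈ B, t ≤ b := by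
  obtain ⟨t, ht, hmax⟩ := hA.exists_maximalFor id A hA'
  exact ⟨t, fun a ha => (le_total a t).elim id fun h => hmax ha h, fun b hb => h t ht b hb⟩

/-- Negative slopes give lower bounds for `t`, positive slopes upper bounds, and the eliminated
inequalities say that they are compatible. Adjoining `-δ` and `δ` keeps them compatible because a
nonzero integer slope has absolute value at least 1. -/
theorem exists_shift_mem_polyhedron [DecidableEq ι] (i : ι) {s : Set (IntAffine ι)} (hs : s.Finite)
    {x : ι → ℝ} (hx : x ∈ polyhedron (eliminate i s)) {δ : ℝ} (hδ : 0 ≤ δ)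
    (h : ∀ a ∈ s, a.ev x ≤ δ) : ∃ t, |t| ≤ δ ∧ x + Pi.single i t ∈ polyhedron s := by
  set A : Set ℝ := insert (-δ) ((fun a : IntAffine ι => a.ev x / -a.1 i) '' {a ∈ s | a.1 i < 0})
  set B : Set ℝ := insert δ ((fun a : IntAffine ι => -a.ev x / a.1 i) '' {a ∈ s | 0 < a.1 i})
  have key : ∀ a ∈ A, ∀ b ∈ B, a ≤ b := by
    rintro _ (rfl | ⟨a, ⟨ha, ha'⟩, rfl⟩) b' (hδ' | ⟨b, ⟨hb, hb'⟩, rfl⟩)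
    · linarith
    · have h1 : (1 : ℝ) ≤ b.1 i := by exact_mod_cast hb'
      have := h b hb
      change _ ≤ -b.ev x / _
      rw [le_div_iff₀ (by linarith)]
      nlinarith
    · have h1 : (a.1 i : ℝ) ≤ -1 := by exact_mod_cast Int.le_sub_one_of_lt ha'
      have := h a ha
      change a.ev x / _ ≤ b'
      rw [div_le_iff₀ (by linarith)]
      nlinarith
    · have h1 : (1 : ℝ) ≤ b.1 i := by exact_mod_cast hb'
      have h2 : (a.1 i : ℝ) ≤ -1 := by exact_mod_cast Int.le_sub_one_of_lt ha'
      have := hx _ (Or.inr ⟨a, ⟨ha, ha'⟩, b, ⟨hb, hb'⟩, rfl⟩)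
      rw [ev_add, ev_zsmul, ev_zsmul] at this
      push_cast at this
      change a.ev x / _ ≤ -b.ev x / _
      rw [div_le_div_iff₀ (by linarith) (by linarith)]
      linarith
  obtain ⟨t, hA, hB⟩ := exists_between_of_finite
    (((hs.subset (sep_subset _ _)).image _).insert _) (insert_nonempty _ _) key
  refine ⟨t, abs_le.2 ⟨hA _ (mem_insert _ _), hB _ (mem_insert _ _)⟩, fun a ha => ?_⟩
  rw [ev_add_single]
  rcases lt_trichotomy (a.1 i) 0 with h0 | h0 | h0
  · have h1 := hA _ (mem_insert_of_mem _ ⟨a, ⟨ha, h0⟩, rfl⟩)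
    have h2 : (a.1 i : ℝ) < 0 := by exact_mod_cast h0
    change a.ev x / _ ≤ t at h1
    rw [div_le_iff₀ (by linarith)] at h1
    linarith
  · have h1 := hx _ (Or.inl ⟨ha, h0⟩)
    rw [h0]
    simpa using h1
  · have h1 := hB _ (mem_insert_of_mem _ ⟨a, ⟨ha, h0⟩, rfl⟩)
    have h2 : (0 : ℝ) < a.1 i := by exact_mod_cast h0
    change t ≤ -a.ev x / _ at h1
    rw [le_div_iff₀ h2] at h1
    linarith

theorem exists_nonneg_bound {α : Type*} {s : Set α} (hs : s.Finite) (F : α → ℝ) :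
    ∃ M, 0 ≤ M ∧ ∀ a ∈ s, F a ≤ M := by
  obtain ⟨M, hM⟩ := (hs.image F).bddAbove
  exact ⟨max M 0, le_max_right _ _, fun a ha => (hM ⟨a, ha, rfl⟩).trans (le_max_left _ _)⟩

/-- Each of the two weights in a combination is at most `M`; the summand 1 serves the inequalities
kept unchanged. -/
theorem ev_le_of_mem_eliminate {i : ι} {s : Set (IntAffine ι)} {M ε : ℝ}
    (hM : ∀ a ∈ s, |(a.1 i : ℝ)| ≤ M) (hM0 : 0 ≤ M) (hε : 0 ≤ ε) {x : ι → ℝ}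
    (h : ∀ a ∈ s, a.ev x ≤ ε) {a : IntAffine ι} (ha : a ∈ eliminate i s) :
    a.ev x ≤ (2 * M + 1) * ε := by
  rcases ha with ha | ⟨a, ⟨ha, ha'⟩, b, ⟨hb, hb'⟩, rfl⟩
  · nlinarith [h a ha.1, mul_nonneg hM0 hε]
  · have h1 : (0 : ℝ) < b.1 i := by exact_mod_cast hb'
    have h2 : (a.1 i : ℝ) < 0 := by exact_mod_cast ha'
    rw [ev_add, ev_zsmul, ev_zsmul]
    push_cast
    have h3 : -(a.1 i : ℝ) * b.ev x ≤ M * ε :=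
      (mul_le_mul_of_nonneg_left (h b hb) (by linarith)).trans
        (mul_le_mul_of_nonneg_right ((neg_le_abs _).trans (hM a ha)) hε)
    have h4 : (b.1 i : ℝ) * a.ev x ≤ M * ε :=
      (mul_le_mul_of_nonneg_left (h a ha) h1.le).trans
        (mul_le_mul_of_nonneg_right ((le_abs_self _).trans (hM b hb)) hε)
    linarith

theorem mem_polyhedron_eliminate_iff [DecidableEq ι] (i : ι) {s : Set (IntAffine ι)}
    (hs : s.Finite) (x : ι → ℝ) :
    x ∈ polyhedron (eliminate i s) ↔ ∃ t, x + Pi.single i t ∈ polyhedron s := by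
  constructor
  · intro hx
    obtain ⟨M, hM0, hM⟩ := exists_nonneg_bound hs fun a => a.ev x
    obtain ⟨t, -, ht⟩ := exists_shift_mem_polyhedron i hs hx hM0 hM
    exact ⟨t, ht⟩
  · rintro ⟨t, ht⟩ a ha
    obtain ⟨M, hM0, hM⟩ := exists_nonneg_bound hs fun a => |(a.1 i : ℝ)|
    have h := ev_le_of_mem_eliminate hM hM0 le_rfl ht ha
    rw [ev_add_single, eliminate_apply_self ha] at h
    simpa using h

/-- Induction on the variables that occur. Eliminating `i` yields a point `y` within `D * ε` of `x`
in the projected polyhedron; by the Lipschitz bound the original inequalities fail at `y` by at most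
`(1 + N * D) * ε`, and a shift of that size along `i` repairs them. -/
theorem exists_hoffman_bound_of_support [DecidableEq ι] (I : Finset ι) :
    ∀ s : Set (IntAffine ι), s.Finite → (∀ a ∈ s, ∀ i ∉ I, a.1 i = 0) → (polyhedron s).Nonempty →
      ∃ C : ℝ, 0 ≤ C ∧ ∀ (ε : ℝ) (x : ι → ℝ), 0 ≤ ε → (∀ a ∈ s, a.ev x ≤ ε) →
        ∃ y ∈ polyhedron s, dist x y ≤ C * ε := by
  induction I using Finset.induction_on with
  | empty =>
    -- With all slopes zero the inequalities are constant, so they hold everywhere once they hold at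
    -- `x₀`.
    rintro s - h0 ⟨x₀, hx₀⟩
    refine ⟨0, le_rfl, fun ε x _ _ => ⟨x, fun a ha => ?_, by simp⟩⟩
    have h1 := hx₀ a ha
    have h2 : a.1 = 0 := funext fun i => h0 a ha i (Finset.notMem_empty i)
    simpa [ev, h2] using h1
  | insert i I hi ih =>
    rintro s hs h0 ⟨x₀, hx₀⟩
    obtain ⟨C, hC, h⟩ := ih (eliminate i s) (finite_eliminate i hs)
      (fun a ha j hj => by
        by_cases hji : j = i
        · rw [hji]; exact eliminate_apply_self ha
        · exact eliminate_apply_eq_zero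
            (fun b hb => h0 b hb j (by simp [hji, hj])) ha)
      ⟨x₀, (mem_polyhedron_eliminate_iff i hs x₀).2 ⟨0, by simpa using hx₀⟩⟩
    obtain ⟨M, hM0, hM⟩ := exists_nonneg_bound hs fun a => |(a.1 i : ℝ)|
    obtain ⟨N, hN0, hN⟩ := exists_nonneg_bound hs fun a => ∑ j, |(a.1 j : ℝ)|
    set D := C * (2 * M + 1) with hD
    have hD0 : 0 ≤ D := by positivity
    refine ⟨D + (1 + N * D), by positivity, fun ε x hε hx => ?_⟩
    obtain ⟨y, hy, hxy⟩ := h ((2 * M + 1) * ε) x (by positivity)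
      fun a ha => ev_le_of_mem_eliminate hM hM0 hε hx ha
    rw [← mul_assoc] at hxy
    obtain ⟨t, ht, hyt⟩ := exists_shift_mem_polyhedron i hs hy (δ := (1 + N * D) * ε)
      (by positivity) fun a ha => by
        have h1 := ev_le_add_dist a y x
        have h2 : (∑ j, |(a.1 j : ℝ)|) * dist y x ≤ N * (D * ε) := by
          rw [dist_comm]
          exact mul_le_mul (hN a ha) hxy dist_nonneg hN0
        linarith [hx a ha]
    refine ⟨_, hyt, (dist_triangle x y _).trans ?_⟩
    have h3 : dist y (y + Pi.single i t) ≤ (1 + N * D) * ε := by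
      rw [dist_self_add_right]
      refine (pi_norm_le_iff_of_nonneg (by positivity)).2 fun j => ?_
      rw [Pi.single_apply]
      split_ifs
      · exact ht
      · rw [norm_zero]; positivity
    linarith

/-- Hoffman's error bound: the distance to a nonempty polyhedron is bounded by a multiple of the
largest violation of its inequalities. -/
theorem exists_hoffman_bound {s : Set (IntAffine ι)} (hs : s.Finite) (h : (polyhedron s).Nonempty) :
    ∃ C : ℝ, 0 ≤ C ∧ ∀ (ε : ℝ) (x : ι → ℝ), 0 ≤ ε → (∀ a ∈ s, a.ev x ≤ ε) →
      ∃ y ∈ polyhedron s, dist x y ≤ C * ε := by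
  classical
  exact exists_hoffman_bound_of_support Finset.univ s hs
    (fun a _ i hi => absurd (Finset.mem_univ i) hi) h

end IntAffine

/-! ### Finite unions of polyhedra and piecewise affine functions. -/

open IntAffine

/-- A polyhedron given by finitely many affine inequalities with integer slopes. -/
def IsIntPolyhedron {ι : Type*} [Fintype ι] (S : Set (ι → ℝ)) : Prop :=
  ∃ s : Set (IntAffine ι), s.Finite ∧ S = polyhedron s

/-- A finite union of polyhedra given by affine inequalities with integer slopes. -/
def IsIntPolyhedral {ι : Type*} [Fintype ι] (S : Set (ι → ℝ)) : Prop :=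
  ∃ T : Set (Set (ι → ℝ)), T.Finite ∧ (∀ P ∈ T, IsIntPolyhedron P) ∧ S = ⋃₀ T

/-- A piecewise affine function: affine with integer slopes on each of finitely many polyhedra that
cover the space. -/
def IsIntPiecewiseAffine {ι : Type*} [Fintype ι] (G : (ι → ℝ) → ℝ) : Prop :=
  ∃ T : Set (Set (ι → ℝ) × IntAffine ι), T.Finite ∧
    (∀ t ∈ T, IsIntPolyhedron t.1 ∧ ∀ x ∈ t.1, G x = t.2.ev x) ∧ ∀ x, ∃ t ∈ T, x ∈ t.1

section Polyhedral

variable {ι κ : Type*} [Fintype ι] [Fintype κ]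

namespace IsIntPolyhedron

theorem inter {S T : Set (ι → ℝ)} (hS : IsIntPolyhedron S) (hT : IsIntPolyhedron T) :
    IsIntPolyhedron (S ∩ T) := by
  obtain ⟨s, hs, rfl⟩ := hS
  obtain ⟨t, ht, rfl⟩ := hT
  refine ⟨s ∪ t, hs.union ht, ?_⟩
  ext x
  simp only [polyhedron, mem_inter_iff, mem_ofPred_eq, mem_union, or_imp, forall_and]

theorem halfspace (a : IntAffine ι) : IsIntPolyhedron {x | a.ev x ≤ 0} :=
  ⟨{a}, finite_singleton a, by ext x; simp [polyhedron]⟩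

theorem univ : IsIntPolyhedron (Set.univ : Set (ι → ℝ)) :=
  ⟨∅, finite_empty, by ext x; simp [polyhedron]⟩

/-- Projection along the coordinates in `J` without a change of index type: one elimination per
coordinate. -/
theorem shift [DecidableEq ι] {P : Set (ι → ℝ)} (hP : IsIntPolyhedron P) (J : Finset ι) :
    IsIntPolyhedron {x | ∃ v : ι → ℝ, (∀ j ∉ J, v j = 0) ∧ x + v ∈ P} := by
  induction J using Finset.induction_on with
  | empty =>
    convert hP using 1
    ext x
    constructor
    · rintro ⟨v, hv, h⟩
      rwa [show v = 0 from funext fun j => hv j (Finset.notMem_empty j), add_zero] at h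
    · exact fun h => ⟨0, fun _ _ => rfl, by simpa using h⟩
  | insert i J hi ih =>
    obtain ⟨s, hs, h⟩ := ih
    refine ⟨eliminate i s, finite_eliminate i hs, ?_⟩
    ext x
    rw [mem_polyhedron_eliminate_iff i hs, ← h]
    constructor
    · rintro ⟨v, hv, hx⟩
      refine ⟨v i, v - Pi.single i (v i), fun j hj => ?_, ?_⟩
      · by_cases hji : j = i
        · subst hji; simp
        · simp [hji, hv j (by simp [hji, hj])]
      · convert hx using 1
        abel
    · rintro ⟨t, v, hv, hx⟩
      refine ⟨Pi.single i t + v, fun j hj => ?_, by rwa [← add_assoc]⟩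
      rw [Finset.mem_insert, not_or] at hj
      simp [hj.1, hv j hj.2]

theorem proj {P : Set (ι ⊕ κ → ℝ)} (hP : IsIntPolyhedron P) :
    IsIntPolyhedron {x : ι → ℝ | ∃ y : κ → ℝ, Sum.elim x y ∈ P} := by
  classical
  obtain ⟨s, hs, h⟩ := hP.shift (Finset.univ.image Sum.inr)
  -- Dropping the `κ`-slopes amounts to slicing at `y = 0`, where the shifted set is tested.
  refine ⟨(fun a => (fun i => a.1 (Sum.inl i), a.2)) '' s, hs.image _, ?_⟩
  ext x
  have h1 : Sum.elim x 0 ∈ polyhedron s ↔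
      x ∈ polyhedron ((fun a : IntAffine (ι ⊕ κ) => ((fun i => a.1 (Sum.inl i), a.2) :
        IntAffine ι)) '' s) := by
    simp only [polyhedron, mem_ofPred_eq, forall_mem_image]
    simp [ev]
  rw [← h1, ← h]
  constructor
  · rintro ⟨y, hy⟩
    refine ⟨Sum.elim 0 y, fun j hj => ?_, ?_⟩
    · rcases j with j | j
      · rfl
      · simp at hj
    · convert hy using 1
      ext (j | j) <;> simp
  · rintro ⟨v, hv, hx⟩
    refine ⟨fun j => v (Sum.inr j), ?_⟩
    convert hx using 1
    ext (j | j)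
    · simp [hv (Sum.inl j)]
    · simp

end IsIntPolyhedron

namespace IsIntPolyhedral

theorem empty : IsIntPolyhedral (∅ : Set (ι → ℝ)) :=
  ⟨∅, finite_empty, by simp, by simp⟩

theorem univ : IsIntPolyhedral (Set.univ : Set (ι → ℝ)) :=
  ⟨{Set.univ}, finite_singleton _, by simpa using IsIntPolyhedron.univ, by simp⟩

theorem inter {S T : Set (ι → ℝ)} (hS : IsIntPolyhedral S) (hT : IsIntPolyhedral T) :
    IsIntPolyhedral (S ∩ T) := by
  obtain ⟨s, hs, hs', rfl⟩ := hS
  obtain ⟨t, ht, ht', rfl⟩ := hT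
  refine ⟨image2 (· ∩ ·) s t, hs.image2 _ ht, ?_, ?_⟩
  · rintro _ ⟨P, hP, Q, hQ, rfl⟩
    exact (hs' P hP).inter (ht' Q hQ)
  · ext x
    constructor
    · rintro ⟨⟨P, hP, hxP⟩, Q, hQ, hxQ⟩
      exact ⟨_, ⟨P, hP, Q, hQ, rfl⟩, hxP, hxQ⟩
    · rintro ⟨_, ⟨P, hP, Q, hQ, rfl⟩, hxP, hxQ⟩
      exact ⟨⟨P, hP, hxP⟩, Q, hQ, hxQ⟩

theorem iInter_finset {α : Type*} (s : Finset α) {S : α → Set (ι → ℝ)}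
    (h : ∀ a, IsIntPolyhedral (S a)) : IsIntPolyhedral {x | ∀ a ∈ s, x ∈ S a} := by
  classical
  induction s using Finset.induction_on with
  | empty => simpa using univ
  | insert a s ha ih =>
    convert (h a).inter ih using 1
    ext x
    simp

theorem proj {S : Set (ι ⊕ κ → ℝ)} (hS : IsIntPolyhedral S) :
    IsIntPolyhedral {x : ι → ℝ | ∃ y : κ → ℝ, Sum.elim x y ∈ S} := by
  obtain ⟨T, hT, hT', rfl⟩ := hS
  refine ⟨(fun P => {x : ι → ℝ | ∃ y : κ → ℝ, Sum.elim x y ∈ P}) '' T, hT.image _, ?_, ?_⟩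
  · rintro _ ⟨P, hP, rfl⟩
    exact (hT' P hP).proj
  · ext x
    constructor
    · rintro ⟨y, P, hP, hy⟩
      exact ⟨_, ⟨P, hP, rfl⟩, y, hy⟩
    · rintro ⟨_, ⟨P, hP, rfl⟩, y, hy⟩
      exact ⟨y, P, hP, hy⟩

end IsIntPolyhedral

namespace IsIntPiecewiseAffine

theorem affine (a : IntAffine ι) : IsIntPiecewiseAffine a.ev :=
  ⟨{(univ, a)}, finite_singleton _, by simpa using IsIntPolyhedron.univ, by simp⟩

theorem neg {F : (ι → ℝ) → ℝ} (hF : IsIntPiecewiseAffine F) :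
    IsIntPiecewiseAffine fun x => -F x := by
  obtain ⟨T, hT, h, hc⟩ := hF
  refine ⟨(fun t => (t.1, -t.2)) '' T, hT.image _, ?_, fun x => ?_⟩
  · rintro _ ⟨t, ht, rfl⟩
    exact ⟨(h t ht).1, fun x hx => by dsimp only; rw [ev_neg, (h t ht).2 x hx]⟩
  · obtain ⟨t, ht, hx⟩ := hc x
    exact ⟨_, ⟨t, ht, rfl⟩, hx⟩

theorem add {F G : (ι → ℝ) → ℝ} (hF : IsIntPiecewiseAffine F) (hG : IsIntPiecewiseAffine G) :
    IsIntPiecewiseAffine fun x => F x + G x := by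
  obtain ⟨T, hT, hF, hTc⟩ := hF
  obtain ⟨U, hU, hG, hUc⟩ := hG
  refine ⟨image2 (fun t u => (t.1 ∩ u.1, t.2 + u.2)) T U, hT.image2 _ hU, ?_, fun x => ?_⟩
  · rintro _ ⟨t, ht, u, hu, rfl⟩
    exact ⟨(hF t ht).1.inter (hG u hu).1, fun x hx => by
      dsimp only; rw [ev_add, (hF t ht).2 x hx.1, (hG u hu).2 x hx.2]⟩
  · obtain ⟨t, ht, hx⟩ := hTc x
    obtain ⟨u, hu, hx'⟩ := hUc x
    exact ⟨_, ⟨t, ht, u, hu, rfl⟩, hx, hx'⟩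

theorem max {F G : (ι → ℝ) → ℝ} (hF : IsIntPiecewiseAffine F) (hG : IsIntPiecewiseAffine G) :
    IsIntPiecewiseAffine fun x => F x ⊔ G x := by
  obtain ⟨T, hT, hF, hTc⟩ := hF
  obtain ⟨U, hU, hG, hUc⟩ := hG
  refine ⟨image2 (fun t u => (t.1 ∩ u.1 ∩ {x | (t.2 - u.2).ev x ≤ 0}, u.2)) T U ∪
    image2 (fun t u => (t.1 ∩ u.1 ∩ {x | (u.2 - t.2).ev x ≤ 0}, t.2)) T U,
    (hT.image2 _ hU).union (hT.image2 _ hU), ?_, fun x => ?_⟩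
  · rintro _ (⟨t, ht, u, hu, rfl⟩ | ⟨t, ht, u, hu, rfl⟩)
    · refine ⟨((hF t ht).1.inter (hG u hu).1).inter (.halfspace _), ?_⟩
      rintro x ⟨⟨h1, h2⟩, h3⟩
      rw [mem_ofPred_eq, ev_sub] at h3
      dsimp only
      rw [(hF t ht).2 x h1, (hG u hu).2 x h2, sup_eq_right]
      linarith
    · refine ⟨((hF t ht).1.inter (hG u hu).1).inter (.halfspace _), ?_⟩
      rintro x ⟨⟨h1, h2⟩, h3⟩
      rw [mem_ofPred_eq, ev_sub] at h3
      dsimp only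
      rw [(hF t ht).2 x h1, (hG u hu).2 x h2, sup_eq_left]
      linarith
  · obtain ⟨t, ht, hx⟩ := hTc x
    obtain ⟨u, hu, hx'⟩ := hUc x
    rcases le_total (t.2.ev x) (u.2.ev x) with h | h
    · exact ⟨_, Or.inl ⟨t, ht, u, hu, rfl⟩, ⟨hx, hx'⟩, by
        rw [mem_ofPred_eq, ev_sub]; linarith⟩
    · exact ⟨_, Or.inr ⟨t, ht, u, hu, rfl⟩, ⟨hx, hx'⟩, by
        rw [mem_ofPred_eq, ev_sub]; linarith⟩

theorem isIntPolyhedral_zeros {F : (ι → ℝ) → ℝ} (hF : IsIntPiecewiseAffine F) :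
    IsIntPolyhedral {x | F x = 0} := by
  obtain ⟨T, hT, h, hc⟩ := hF
  refine ⟨(fun t => t.1 ∩ ({x | t.2.ev x ≤ 0} ∩ {x | (-t.2).ev x ≤ 0})) '' T, hT.image _, ?_, ?_⟩
  · rintro _ ⟨t, ht, rfl⟩
    exact (h t ht).1.inter ((IsIntPolyhedron.halfspace _).inter (.halfspace _))
  · ext x
    constructor
    · intro hx
      obtain ⟨t, ht, hxt⟩ := hc x
      have h1 := (h t ht).2 x hxt
      rw [show F x = 0 from hx] at h1
      exact ⟨_, ⟨t, ht, rfl⟩, hxt, h1.ge, by simp [ev_neg, ← h1]⟩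
    · rintro ⟨_, ⟨t, ht, rfl⟩, hxt, h1, h2⟩
      rw [mem_ofPred_eq, ev_neg] at h2
      rw [mem_ofPred_eq] at h1
      rw [mem_ofPred_eq, (h t ht).2 x hxt]
      linarith

end IsIntPiecewiseAffine

end Polyhedral

/-! ### Values of tropical polynomials and rational functions. -/

namespace TropReal

theorem ofReal_injective : Function.Injective ofReal := fun a b h => by
  have h1 := Tropical.trop_injective h
  exact OrderDual.toDual.injective (WithTop.coe_injective h1)

theorem ofReal_add (a b : ℝ) : ofReal (a + b) = ofReal a * ofReal b := rfl

theorem ofReal_max (a b : ℝ) : ofReal (a ⊔ b) = ofReal a + ofReal b := by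
  rw [ofReal, ofReal, ofReal, ← Tropical.trop_inf, toDual_sup, WithTop.coe_inf]

theorem ofReal_zero : ofReal 0 = 1 := rfl

theorem ofReal_mul_ofReal_neg (a : ℝ) : ofReal a * ofReal (-a) = 1 := by
  rw [← ofReal_add, add_neg_cancel, ofReal_zero]

theorem ofReal_nsmul (k : ℕ) (a : ℝ) : ofReal (k * a) = ofReal a ^ k := by
  induction k with
  | zero => simp [ofReal_zero]
  | succ k ih => rw [pow_succ, ← ih, ← ofReal_add]; congr 1; push_cast; ring

end TropReal

open TropReal

namespace TropPolyFun

variable {n : ℕ}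

theorem ext_eval {p q : TropPolyFun n} (h : ∀ x, eval x p = eval x q) : p = q := by
  obtain ⟨p, rfl⟩ := RingCon.mk'_surjective _ p
  obtain ⟨q, rfl⟩ := RingCon.mk'_surjective _ q
  exact (RingCon.eq _).2 fun x _ => h x

theorem mem_nonZeroDivisors {p : TropPolyFun n} (hp : p ≠ 0) : p ∈ nonZeroDivisors _ := by
  have h : ∀ q : TropPolyFun n, q * p = 0 → q = 0 := fun q hq => by
    have hx : ∀ i : Fin n, (fun _ => 1 : Fin n → TropReal) i ≠ 0 := fun _ => one_ne_zero
    have h1 := congrArg (eval fun _ => 1) hq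
    rw [map_mul, map_zero, mul_eq_zero] at h1
    exact eq_zero_of_eval_eq_zero hx (h1.resolve_right fun h => hp (eq_zero_of_eval_eq_zero hx h))
  exact mem_nonZeroDivisors_iff.2 ⟨fun q hq => h q (by rwa [mul_comm]), h⟩

/-- The tropical polynomial function given by the `i`-th variable. -/
noncomputable def X (i : Fin n) : TropPolyFun n := RingCon.mk' _ (MvPolynomial.X i)

theorem eval_X (x : Fin n → TropReal) (i : Fin n) : eval x (X i) = x i :=
  MvPolynomial.eval_X (f := x) i

end TropPolyFun

namespace TropRatFun

variable {n m : ℕ}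

theorem eval_algebraMap (x : Fin n → ℝ) (p : TropPolyFun n) :
    eval x (algebraMap _ _ p) = TropPolyFun.eval (fun i => ofReal (x i)) p :=
  IsLocalization.lift_eq _ _

theorem eval_X (x : Fin n → ℝ) (i : Fin n) : eval x (X i) = ofReal (x i) :=
  (eval_algebraMap x _).trans (TropPolyFun.eval_X _ i)

/-- A constant tropical rational function is given by a constant polynomial. -/
theorem algebraMap_eq (c : TropReal) : algebraMap TropReal (TropRatFun n) c =
    algebraMap (TropPolyFun n) (TropRatFun n) (RingCon.mk' _ (MvPolynomial.C c)) := by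
  rw [IsScalarTower.algebraMap_apply TropReal (TropPolyFun n) (TropRatFun n)]
  rfl

theorem eval_const (x : Fin n → ℝ) (c : TropReal) : eval x (algebraMap _ _ c) = c := by
  rw [algebraMap_eq, eval_algebraMap]
  exact MvPolynomial.eval_C c

/-- Tropical rational functions are determined by their values at the points of `ℝⁿ`. -/
theorem ext_eval {f g : TropRatFun n} (h : ∀ x, eval x f = eval x g) : f = g := by
  obtain ⟨p, s, rfl⟩ := IsLocalization.exists_mk'_eq (nonZeroDivisors (TropPolyFun n)) f
  obtain ⟨q, t, rfl⟩ := IsLocalization.exists_mk'_eq (nonZeroDivisors (TropPolyFun n)) g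
  rw [IsLocalization.mk'_eq_iff_eq]
  have key : ∀ x : Fin n → ℝ, TropPolyFun.eval (fun i => ofReal (x i)) (t * p) =
      TropPolyFun.eval (fun i => ofReal (x i)) (s * q) := fun x => by
    have hp := congrArg (eval x) (IsLocalization.mk'_spec (TropRatFun n) p s)
    have hq := congrArg (eval x) (IsLocalization.mk'_spec (TropRatFun n) q t)
    rw [map_mul, eval_algebraMap, eval_algebraMap] at hp hq
    rw [map_mul, map_mul, ← hp, ← hq, h x]
    ring
  -- Polynomial functions are compared on all of `(ℝ ∪ {-∞})ⁿ`, but `key` covers only `ℝⁿ`.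
  -- Multiplying by the product of the variables makes both sides `-∞` at the other points; it
  -- cancels in the semifield.
  have hX : (∏ i, TropPolyFun.X i : TropPolyFun n) ≠ 0 := fun h0 => by
    have h1 := congrArg (TropPolyFun.eval fun _ => 1) h0
    simp [map_prod, TropPolyFun.eval_X] at h1
  have h2 : (∏ i, TropPolyFun.X i) * ((t : TropPolyFun n) * p) =
      (∏ i, TropPolyFun.X i) * ((s : TropPolyFun n) * q) := by
    refine TropPolyFun.ext_eval fun x => ?_
    rw [map_mul, map_mul _ _ (_ * q), map_prod]
    simp only [TropPolyFun.eval_X]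
    by_cases hx : ∃ i, x i = 0
    · obtain ⟨i, hi⟩ := hx
      rw [Finset.prod_eq_zero (Finset.mem_univ i) hi, zero_mul, zero_mul]
    · push Not at hx
      have h3 := key fun i => toReal (x i) (hx i)
      simp only [ofReal_toReal] at h3
      rw [h3]
  have h3 := congrArg (algebraMap (TropPolyFun n) (TropRatFun n)) h2
  rw [map_mul, map_mul _ _ (_ * q)] at h3
  exact (IsLocalization.map_units (TropRatFun n)
    ⟨_, TropPolyFun.mem_nonZeroDivisors hX⟩).mul_left_cancel h3

theorem exists_mul_eq_one {f : TropRatFun n} (hf : f ≠ 0) : ∃ g, f * g = 1 := by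
  obtain ⟨p, s, rfl⟩ := IsLocalization.exists_mk'_eq (nonZeroDivisors (TropPolyFun n)) f
  have hp : p ≠ 0 := fun h => hf (by rw [h, IsLocalization.mk'_zero])
  exact ⟨IsLocalization.mk' _ (s : TropPolyFun n) ⟨p, TropPolyFun.mem_nonZeroDivisors hp⟩,
    IsLocalization.mk'_mul_mk'_eq_one' _ _ _⟩

/-- The values of nonzero tropical rational functions on `ℝⁿ`, pulled back along `π`, lie in every
class of functions that contains the constants and the coordinates of `π` and is closed under sums,
negation and maxima. -/
theorem exists_eval_eq_ofReal {Z : Type*} [Nonempty Z] (π : Z → Fin n → ℝ) {Q : (Z → ℝ) → Prop}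
    (const : ∀ c, Q fun _ => c) (coord : ∀ i, Q fun z => π z i)
    (add : ∀ F G, Q F → Q G → Q fun z => F z + G z) (neg : ∀ F, Q F → Q fun z => -F z)
    (max : ∀ F G, Q F → Q G → Q fun z => F z ⊔ G z) {f : TropRatFun n} (hf : f ≠ 0) :
    ∃ G, Q G ∧ ∀ z, eval (π z) f = ofReal (G z) := by
  -- Along `π` a polynomial is either identically `-∞` or real-valued everywhere; the first case is
  -- excluded below for nonzero classes.
  have poly : ∀ p : MvPolynomial (Fin n) TropReal,
      (∀ z, MvPolynomial.eval (fun i => ofReal (π z i)) p = 0) ∨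
      ∃ G, Q G ∧ ∀ z, MvPolynomial.eval (fun i => ofReal (π z i)) p = ofReal (G z) := by
    intro p
    induction p using MvPolynomial.induction_on with
    | C a =>
      by_cases ha : a = 0
      · left; simp [ha]
      · exact Or.inr ⟨_, const (toReal a ha), fun z => by
          rw [MvPolynomial.eval_C, ofReal_toReal]⟩
    | add p q hp hq =>
      simp only [map_add]
      rcases hp with hp | ⟨F, hF, hp⟩
      · simpa only [hp, zero_add] using hq
      · rcases hq with hq | ⟨G, hG, hq⟩
        · exact Or.inr ⟨F, hF, fun z => by rw [hp, hq, add_zero]⟩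
        · exact Or.inr ⟨_, max F G hF hG, fun z => by rw [hp, hq, ofReal_max]⟩
    | mul_X p i hp =>
      simp only [map_mul, MvPolynomial.eval_X]
      rcases hp with hp | ⟨F, hF, hp⟩
      · left; simp [hp]
      · exact Or.inr ⟨_, add F _ hF (coord i), fun z => by rw [hp, ofReal_add]⟩
  have poly' : ∀ p : TropPolyFun n, p ≠ 0 →
      ∃ G, Q G ∧ ∀ z, eval (π z) (algebraMap _ _ p) = ofReal (G z) := by
    intro p hp
    simp only [eval_algebraMap]
    obtain ⟨q, rfl⟩ := RingCon.mk'_surjective _ p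
    refine (poly q).resolve_left fun h => hp ?_
    obtain ⟨z⟩ := ‹Nonempty Z›
    exact TropPolyFun.eq_zero_of_eval_eq_zero (fun i => ofReal_ne_zero (π z i)) (h z)
  obtain ⟨p, s, rfl⟩ := IsLocalization.exists_mk'_eq (nonZeroDivisors (TropPolyFun n)) f
  have hp : p ≠ 0 := fun h => hf (by rw [h, IsLocalization.mk'_zero])
  have hs : (s : TropPolyFun n) ≠ 0 := fun h => by
    have h1 := TropPolyFun.isUnit_eval (x := fun _ => 1) (fun _ => one_ne_zero) s
    rw [h, map_zero, isUnit_zero_iff] at h1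
    exact zero_ne_one h1
  obtain ⟨F, hF, hF'⟩ := poly' p hp
  obtain ⟨G, hG, hG'⟩ := poly' s hs
  refine ⟨_, add _ _ hF (neg _ hG), fun z => ?_⟩
  have h := congrArg (eval (π z)) (IsLocalization.mk'_spec (TropRatFun n) p s)
  rw [map_mul, hF', hG'] at h
  rw [ofReal_add, ← h, mul_assoc, ofReal_mul_ofReal_neg, mul_one]

theorem exists_eval_eq_ofReal_piecewiseAffine {ι : Type*} [Fintype ι] (σ : Fin n → ι)
    {f : TropRatFun n} (hf : f ≠ 0) :
    ∃ G, IsIntPiecewiseAffine G ∧ ∀ z : ι → ℝ, eval (z ∘ σ) f = ofReal (G z) := by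
  classical
  refine exists_eval_eq_ofReal (fun z => z ∘ σ) (fun c => ?_) (fun i => ?_) (fun _ _ => .add)
    (fun _ => .neg) (fun _ _ => .max) hf
  · convert IsIntPiecewiseAffine.affine ((0, c) : IntAffine ι) using 2 with z
    rw [ev_const]
  · convert IsIntPiecewiseAffine.affine ((Pi.single (σ i) 1, 0) : IntAffine ι) using 2 with z
    rw [ev_single]
    rfl

theorem exists_eval_eq_ofReal_lipschitz {f : TropRatFun n} (hf : f ≠ 0) :
    ∃ G : (Fin n → ℝ) → ℝ, (∃ K, LipschitzWith K G) ∧ ∀ x, eval x f = ofReal (G x) :=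
  exists_eval_eq_ofReal id (fun c => ⟨0, .const c⟩) (fun i => ⟨1, LipschitzWith.eval i⟩)
    (fun _ _ ⟨_, h⟩ ⟨_, h'⟩ => ⟨_, h.add h'⟩) (fun _ ⟨_, h⟩ => ⟨_, h.neg⟩)
    (fun _ _ ⟨_, h⟩ ⟨_, h'⟩ => ⟨_, h.max h'⟩) hf

/-- A real-valued function on `ℝⁿ` given by a tropical rational function. -/
def IsRat (G : (Fin n → ℝ) → ℝ) : Prop := ∃ f : TropRatFun n, ∀ x, eval x f = ofReal (G x)

/-! ### Real functions given by tropical rational functions. -/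

namespace IsRat

theorem const (c : ℝ) : IsRat fun _ : Fin n → ℝ => c :=
  ⟨algebraMap _ _ (ofReal c), fun x => eval_const x _⟩

theorem coord (i : Fin n) : IsRat fun x => x i := ⟨X i, fun x => eval_X x i⟩

theorem add {F G : (Fin n → ℝ) → ℝ} (hF : IsRat F) (hG : IsRat G) :
    IsRat fun x => F x + G x := by
  obtain ⟨f, hf⟩ := hF
  obtain ⟨g, hg⟩ := hG
  exact ⟨f * g, fun x => by rw [map_mul, hf, hg, ofReal_add]⟩

theorem max {F G : (Fin n → ℝ) → ℝ} (hF : IsRat F) (hG : IsRat G) :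
    IsRat fun x => F x ⊔ G x := by
  obtain ⟨f, hf⟩ := hF
  obtain ⟨g, hg⟩ := hG
  exact ⟨f + g, fun x => by rw [map_add, hf, hg, ofReal_max]⟩

theorem neg {F : (Fin n → ℝ) → ℝ} (hF : IsRat F) : IsRat fun x => -F x := by
  obtain ⟨f, hf⟩ := hF
  obtain ⟨g, hg⟩ := exists_mul_eq_one (f := f) fun h => by
    have h1 := hf 0
    rw [h, map_zero] at h1
    exact ofReal_ne_zero _ h1.symm
  refine ⟨g, fun x => ?_⟩
  have h := congrArg (eval x) hg
  rw [map_mul, map_one, hf] at h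
  rw [← mul_one (ofReal _), ← h, ← mul_assoc, mul_comm (ofReal (-F x)), ofReal_mul_ofReal_neg,
    one_mul]

theorem min {F G : (Fin n → ℝ) → ℝ} (hF : IsRat F) (hG : IsRat G) :
    IsRat fun x => F x ⊓ G x := by
  simpa only [max_neg_neg, neg_neg] using (hF.neg.max hG.neg).neg

theorem sum {α : Type*} (s : Finset α) {F : α → (Fin n → ℝ) → ℝ} (h : ∀ a, IsRat (F a)) :
    IsRat fun x => ∑ a ∈ s, F a x := by
  classical
  induction s using Finset.induction_on with
  | empty => simpa using const 0
  | insert a s ha ih => simpa only [Finset.sum_insert ha] using (h a).add ih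

theorem nsmul {F : (Fin n → ℝ) → ℝ} (hF : IsRat F) (k : ℕ) : IsRat fun x => k * F x := by
  simpa using sum (Finset.range k) fun _ => hF

theorem zsmul {F : (Fin n → ℝ) → ℝ} (hF : IsRat F) (k : ℤ) : IsRat fun x => k * F x := by
  obtain ⟨k, rfl | rfl⟩ := k.eq_nat_or_neg
  · simpa using hF.nsmul k
  · simpa using (hF.nsmul k).neg

theorem affine (a : IntAffine (Fin n)) : IsRat a.ev :=
  (sum Finset.univ fun i => (coord i).zsmul (a.1 i)).add (const a.2)

/-- The largest violation of finitely many inequalities is a tropical rational function. -/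
theorem exists_violation {s : Set (IntAffine (Fin n))} (hs : s.Finite) :
    ∃ F : (Fin n → ℝ) → ℝ, IsRat F ∧ (∀ x, 0 ≤ F x) ∧ (∀ a ∈ s, ∀ x, a.ev x ≤ F x) ∧
      ∀ x ∈ polyhedron s, F x = 0 := by
  induction s, hs using Set.Finite.induction_on with
  | empty => exact ⟨_, const 0, by simp, by simp, by simp⟩
  | @insert a s _ _ ih =>
    obtain ⟨F, hF, h0, h1, h2⟩ := ih
    refine ⟨_, hF.max (affine a), fun x => le_max_of_le_left (h0 x), ?_, fun x hx => ?_⟩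
    · rintro b (rfl | hb) x
      · exact le_max_right _ _
      · exact (h1 b hb x).trans (le_max_left _ _)
    · rw [h2 x fun b hb => hx b (mem_insert_of_mem _ hb)]
      exact max_eq_left (hx a (mem_insert _ _))

end IsRat

/-- A union of polyhedra is the zero set of a tropical rational function that bounds the distance
to the union. -/
theorem exists_isRat_dist_le {T : Set (Set (Fin n → ℝ))} (hT : T.Finite)
    (h : ∀ P ∈ T, IsIntPolyhedron P) (hne : (⋃₀ T).Nonempty) :
    ∃ F : (Fin n → ℝ) → ℝ, IsRat F ∧ (∀ x, 0 ≤ F x) ∧ (∀ x ∈ ⋃₀ T, F x = 0) ∧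
      ∃ C : ℝ, 0 ≤ C ∧ ∀ x, ∃ y ∈ ⋃₀ T, dist x y ≤ C * F x := by
  induction T, hT using Set.Finite.induction_on with
  | empty => simp at hne
  | @insert P T _ _ ih =>
    obtain ⟨s, hs, hP⟩ := h P (mem_insert _ _)
    rw [sUnion_insert] at hne ⊢
    have h' : ∀ P ∈ T, IsIntPolyhedron P := fun Q hQ => h Q (mem_insert_of_mem _ hQ)
    -- Hoffman's bound needs a nonempty polyhedron, so empty ones are discarded.
    by_cases hPe : P = ∅
    · rw [hPe, empty_union] at hne ⊢
      exact ih h' hne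
    have hPn := nonempty_iff_ne_empty.2 hPe
    obtain ⟨F, hF, hF0, hFs, hFP⟩ := IsRat.exists_violation hs
    subst hP
    obtain ⟨C, hC, hC'⟩ := exists_hoffman_bound hs hPn
    have hC' : ∀ x, ∃ y ∈ polyhedron s, dist x y ≤ C * F x := fun x =>
      hC' _ x (hF0 x) fun a ha => hFs a ha x
    by_cases hTe : ⋃₀ T = ∅
    · rw [hTe, union_empty]
      exact ⟨F, hF, hF0, hFP, C, hC, hC'⟩
    obtain ⟨G, hG, hG0, hGT, D, hD, hD'⟩ := ih h' (nonempty_iff_ne_empty.2 hTe)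
    refine ⟨_, hF.min hG, fun x => le_min (hF0 x) (hG0 x), ?_, C + D, by positivity, fun x => ?_⟩
    · rintro x (hx | hx)
      · rw [hFP x hx, min_eq_left (hG0 x)]
      · rw [hGT x hx, min_eq_right (hF0 x)]
    · rcases le_total (F x) (G x) with hx | hx
      · obtain ⟨y, hy, hxy⟩ := hC' x
        refine ⟨y, Or.inl hy, hxy.trans ?_⟩
        rw [min_eq_left hx]
        nlinarith [hF0 x]
      · obtain ⟨y, hy, hxy⟩ := hD' x
        refine ⟨y, Or.inr hy, hxy.trans ?_⟩
        rw [min_eq_right hx]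
        nlinarith [hG0 x]

/-! ### Finite generation for polyhedral sets, and images of solution sets. -/

theorem E_empty_finitelyGenerated : (E (∅ : Set (Fin n → ℝ))).FinitelyGenerated := by
  refine ⟨{(0, 1)}, le_antisymm (fun _ _ _ x hx => hx.elim) fun f g _ => ?_⟩
  set c := ringConGen fun f g : TropRatFun n => (f, g) ∈ ({(0, 1)} : Finset _)
  have h01 : c 0 1 := RingConGen.Rel.of _ _ (by simp)
  have h : ∀ f, c 0 f := fun f => by simpa using c.mul h01 (c.refl f)
  exact c.trans (c.symm (h f)) (h g)

/-- The congruence of a finite union of polyhedra is finitely generated. -/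
theorem E_finitelyGenerated {S : Set (Fin n → ℝ)} (hS : IsIntPolyhedral S) :
    (E S).FinitelyGenerated := by
  obtain ⟨T, hT, hTP, rfl⟩ := hS
  rcases (⋃₀ T).eq_empty_or_nonempty with he | hne
  · rw [he]
    exact E_empty_finitelyGenerated
  obtain ⟨F, ⟨h, hF⟩, hF0, hFS, C, hC, hdist⟩ := exists_isRat_dist_le hT hTP hne
  refine ⟨{(h, 1)}, ?_⟩
  set c := ringConGen fun f g : TropRatFun n => (f, g) ∈ ({(h, 1)} : Finset _) with hc
  refine le_antisymm (RingCon.ringConGen_le.2 ?_) ?_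
  · intro f g hfg x hx
    obtain ⟨rfl, rfl⟩ : f = h ∧ g = 1 := by simpa using hfg
    rw [hF, hFS x hx, map_one, ofReal_zero]
  have hh : c h 1 := RingConGen.Rel.of _ _ (by simp)
  intro f g hfg
  obtain ⟨x₀, hx₀⟩ := hne
  by_cases hf : f = 0
  · by_cases hg : g = 0
    · rw [hf, hg]; exact c.refl 0
    · exact absurd (hfg x₀ hx₀).symm (by rw [hf, map_zero]; exact eval_ne_zero hg x₀)
  by_cases hg : g = 0
  · exact absurd (hfg x₀ hx₀) (by rw [hg, map_zero]; exact eval_ne_zero hf x₀)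
  obtain ⟨A, ⟨K, hA⟩, hfA⟩ := exists_eval_eq_ofReal_lipschitz hf
  obtain ⟨B, ⟨L, hB⟩, hgB⟩ := exists_eval_eq_ofReal_lipschitz hg
  obtain ⟨k, hk⟩ := exists_nat_ge ((K + L) * C : ℝ)
  -- Compare both values with the common value at a point `y` of the union with `dist x y ≤ C * F
  -- x`.
  have hAB : ∀ x, |A x - B x| ≤ k * F x := fun x => by
    obtain ⟨y, hy, hxy⟩ := hdist x
    have h1 := hA.dist_le_mul x y
    have h2 := hB.dist_le_mul x y
    have h3 : A y = B y := ofReal_injective (by rw [← hfA, ← hgB]; exact hfg y hy)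
    have h4 : (K + L : ℝ) * dist x y ≤ (K + L) * (C * F x) := by gcongr
    have h5 : ((K + L) * C : ℝ) * F x ≤ k * F x := mul_le_mul_of_nonneg_right hk (hF0 x)
    rw [Real.dist_eq, h3] at h1
    rw [Real.dist_eq] at h2
    have h6 : |A x - B x| ≤ |A x - B y| + |B x - B y| := by
      rw [abs_sub_comm (B x)]
      exact abs_sub_le _ _ _
    linarith
  have hpow : c (h ^ k) 1 := by simpa using c.pow k hh
  -- The hypothesis says `f ≤ g + k * F`. Since `h ^ k ~ 1`, `f + g ~ f + g * h ^ k = g * h ^ k ~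
  -- g`.
  have absorb : ∀ {f g : TropRatFun n}, f + g * h ^ k = g * h ^ k → c (f + g) g := fun {f g} e => by
    have h1 : c (g * h ^ k) g := by simpa using c.mul (c.refl g) hpow
    have h2 := c.add (c.refl f) h1
    rw [e] at h2
    exact c.trans (c.symm h2) h1
  have h1 : c (f + g) g := absorb <| ext_eval fun x => by
    rw [map_add, map_mul, map_pow, hfA, hgB, hF, ← ofReal_nsmul, ← ofReal_add, ← ofReal_max,
      max_eq_right (by linarith [(abs_le.1 (hAB x)).2])]
  have h2 : c (g + f) f := absorb <| ext_eval fun x => by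
    rw [map_add, map_mul, map_pow, hfA, hgB, hF, ← ofReal_nsmul, ← ofReal_add, ← ofReal_max,
      max_eq_right (by linarith [(abs_le.1 (hAB x)).1])]
  rw [add_comm] at h2
  exact c.trans (c.symm h2) h1

/-- The points at which two tropical rational functions agree form a finite union of polyhedra. -/
theorem isIntPolyhedral_eval_eq {ι : Type*} [Fintype ι] (σ : Fin n → ι) (f g : TropRatFun n) :
    IsIntPolyhedral {z : ι → ℝ | eval (z ∘ σ) f = eval (z ∘ σ) g} := by
  by_cases hf : f = 0
  · by_cases hg : g = 0
    · convert IsIntPolyhedral.univ (ι := ι) using 1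
      simp [hf, hg]
    · convert IsIntPolyhedral.empty (ι := ι) using 1
      ext z
      simpa [hf] using (eval_ne_zero hg _).symm
  by_cases hg : g = 0
  · convert IsIntPolyhedral.empty (ι := ι) using 1
    ext z
    simpa [hg] using eval_ne_zero hf _
  obtain ⟨A, hA, hfA⟩ := exists_eval_eq_ofReal_piecewiseAffine σ hf
  obtain ⟨B, hB, hgB⟩ := exists_eval_eq_ofReal_piecewiseAffine σ hg
  convert (hA.add hB.neg).isIntPolyhedral_zeros using 1
  ext z
  simp only [mem_ofPred_eq, hfA, hgB, ofReal_injective.eq_iff, ← sub_eq_add_neg, sub_eq_zero]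

theorem ofReal_toMap (f : Fin n → TropRatFun m) (hf : ∀ i, f i ≠ 0) (y : Fin m → ℝ) (i : Fin n) :
    ofReal (toMap f hf y i) = eval y (f i) := ofReal_toReal _ _

theorem toMap_eq_iff (f : Fin n → TropRatFun m) (hf : ∀ i, f i ≠ 0) (y : Fin m → ℝ)
    (x : Fin n → ℝ) : toMap f hf y = x ↔ ∀ i, eval y (f i) = ofReal (x i) := by
  simp only [← ofReal_toMap f hf, ofReal_injective.eq_iff, funext_iff]

/-- The image of the common solutions of finitely many equations under a map given by tropical
rational functions is a finite union of polyhedra. -/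
theorem isIntPolyhedral_image_toMap (f : Fin n → TropRatFun m) (hf : ∀ i, f i ≠ 0)
    (s : Finset (TropRatFun m × TropRatFun m)) :
    IsIntPolyhedral (toMap f hf '' {y | ∀ p ∈ s, eval y p.1 = eval y p.2}) := by
  have h1 : IsIntPolyhedral {z : Fin n ⊕ Fin m → ℝ | ∀ p ∈ s,
      z ∈ {z | eval (z ∘ Sum.inr) p.1 = eval (z ∘ Sum.inr) p.2}} :=
    .iInter_finset s fun p => isIntPolyhedral_eval_eq _ _ _
  -- The graph of the map; the image is the projection of its part over the solution set.
  have h2 : IsIntPolyhedral {z : Fin n ⊕ Fin m → ℝ | ∀ i ∈ Finset.univ,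
      z ∈ {z | eval (z ∘ Sum.inr) (f i) = ofReal (z (Sum.inl i))}} := by
    refine .iInter_finset _ fun i => ?_
    obtain ⟨A, hA, hfA⟩ := exists_eval_eq_ofReal_piecewiseAffine (ι := Fin n ⊕ Fin m) Sum.inr (hf i)
    have hB := IsIntPiecewiseAffine.affine
      ((Pi.single (Sum.inl i) 1, 0) : IntAffine (Fin n ⊕ Fin m))
    convert (hA.add hB.neg).isIntPolyhedral_zeros using 1
    ext z
    simp only [mem_ofPred_eq, hfA, ofReal_injective.eq_iff, ev_single, ← sub_eq_add_neg,
      sub_eq_zero]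
  convert (h1.inter h2).proj using 1
  ext x
  simp only [mem_image, toMap_eq_iff]
  simp [← Function.comp_def]

/-- Composition with a map given by tropical rational functions. -/
theorem exists_eval_toMap (f : Fin n → TropRatFun m) (hf : ∀ i, f i ≠ 0) (g : TropRatFun n) :
    ∃ h : TropRatFun m, ∀ y, eval y h = eval (toMap f hf y) g := by
  by_cases hg : g = 0
  · exact ⟨0, fun y => by rw [hg, map_zero, map_zero]⟩
  obtain ⟨G, hG, hG'⟩ := exists_eval_eq_ofReal (toMap f hf) (Q := IsRat) IsRat.const
    (fun i => ⟨f i, fun y => (ofReal_toMap f hf y i).symm⟩) (fun _ _ => .add) (fun _ => .neg)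
    (fun _ _ => .max) hg
  obtain ⟨h, hh⟩ := hG
  exact ⟨h, fun y => by rw [hh, hG']⟩

/-- Homomorphisms that fix the constants are determined by the images of the variables. -/
theorem ringHom_ext {φ φ' : TropRatFun n →+* TropReal}
    (hC : ∀ c : TropReal, φ (algebraMap _ _ c) = φ' (algebraMap _ _ c))
    (hX : ∀ i, φ (X i) = φ' (X i)) : φ = φ' := by
  refine IsLocalization.ringHom_ext (nonZeroDivisors (TropPolyFun n)) ?_
  refine RingCon.Quotient.hom_ext ?_
  refine MvPolynomial.ringHom_ext (fun c => ?_) hX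
  have h := hC c
  rwa [algebraMap_eq] at h

end TropRatFun

/-! ### Homomorphisms between the quotient algebras. -/

namespace TropRatFun

variable {n m : ℕ} {V : Set (Fin n → ℝ)} {W : Set (Fin m → ℝ)}

/-- A homomorphism of quotient algebras is given by composition with the map defined by the images
of the variables. -/
theorem eval_eq_eval_toMap
    (ψ : (E V).Quotient →ₐ[TropReal] (E W).Quotient)
    (f : Fin n → TropRatFun m) (hf : ∀ i, f i ≠ 0)
    (hψ : ∀ i, (E W).mk' (f i) = ψ ((E V).mk' (X i))) {g : TropRatFun n} {h : TropRatFun m}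
    (hgh : (E W).mk' h = ψ ((E V).mk' g)) {y : Fin m → ℝ} (hy : y ∈ W) :
    eval y h = eval (toMap f hf y) g := by
  -- Evaluation at `y ∈ W` descends to the quotient. Composed with `ψ` it fixes constants and sends
  -- `X i` to the value of `f i` at `y`, so it is evaluation at the image point.
  let ε : (E W).Quotient →+* TropReal := (E W).lift (eval y) fun _ _ h => h y hy
  have hφ : (ε.comp ψ.toRingHom).comp (E V).mk' = eval (toMap f hf y) := by
    refine ringHom_ext (fun c => ?_) fun i => ?_
    · have h1 : ψ ((E V).mk' (algebraMap TropReal _ c)) = (E W).mk' (algebraMap TropReal _ c) :=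
        ψ.commutes c
      change ε (ψ ((E V).mk' (algebraMap TropReal _ c))) = _
      rw [h1, eval_const]
      exact eval_const y c
    · change ε (ψ ((E V).mk' (X i))) = _
      rw [← hψ, eval_X, ofReal_toMap]
      rfl
  rw [← hφ]
  change _ = ε (ψ ((E V).mk' g))
  rw [← hgh]
  rfl

/-- If `E W` is finitely generated and the algebra of `V` embeds into that of `W`, then `E V` is
finitely generated. -/
theorem finitelyGenerated_of_injective
    (ψ : (E V).Quotient →ₐ[TropReal] (E W).Quotient)
    (f : Fin n → TropRatFun m) (hf : ∀ i, f i ≠ 0)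
    (hψ : ∀ i, (E W).mk' (f i) = ψ ((E V).mk' (X i))) (hinj : Function.Injective ψ)
    (hW : (E W).FinitelyGenerated) : (E V).FinitelyGenerated := by
  obtain ⟨s, hs⟩ := hW
  set Z : Set (Fin m → ℝ) := {y | ∀ p ∈ s, eval y p.1 = eval y p.2} with hZ
  -- `Z` contains `W`, and the generators of `E W` hold on `Z` by construction.
  have hWZ : E W = E Z := by
    refine le_antisymm ?_ ?_
    · rw [← hs]
      exact RingCon.ringConGen_le.2 fun a b hab y hy => hy (a, b) hab
    · intro a b hab y hy
      refine hab y fun p hp => ?_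
      have h1 : E W p.1 p.2 := by rw [← hs]; exact RingConGen.Rel.of _ _ hp
      exact h1 y hy
  have hV : E V = E (toMap f hf '' Z) := by
    refine RingCon.ext fun a b => ?_
    obtain ⟨a', ha⟩ := exists_eval_toMap f hf a
    obtain ⟨b', hb⟩ := exists_eval_toMap f hf b
    have key : ∀ {g : TropRatFun n} {g' : TropRatFun m},
        (∀ y, eval y g' = eval (toMap f hf y) g) → (E W).mk' g' = ψ ((E V).mk' g) := by
      intro g g' hg
      obtain ⟨h, hh⟩ := RingCon.mk'_surjective _ (ψ ((E V).mk' g))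
      rw [← hh]
      exact (RingCon.eq _).2 fun y hy => by rw [hg, eval_eq_eval_toMap ψ f hf hψ hh hy]
    calc E V a b ↔ (E V).mk' a = (E V).mk' b := (RingCon.eq _).symm
      _ ↔ (E W).mk' a' = (E W).mk' b' := by rw [key ha, key hb, hinj.eq_iff]
      _ ↔ E W a' b' := RingCon.eq _
      _ ↔ E Z a' b' := by rw [hWZ]
      _ ↔ E (toMap f hf '' Z) a b := by
        change (∀ y ∈ Z, _) ↔ ∀ x ∈ toMap f hf '' Z, _
        simp only [forall_mem_image, ha, hb]
  rw [hV]
  exact E_finitelyGenerated (isIntPolyhedral_image_toMap f hf s)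

/-- The image of a variable under an algebra homomorphism has a nonzero representative. -/
theorem exists_ne_zero_mk'_eq
    (ψ : (E V).Quotient →ₐ[TropReal] (E W).Quotient) (i : Fin n) :
    ∃ f : TropRatFun m, f ≠ 0 ∧ (E W).mk' f = ψ ((E V).mk' (X i)) := by
  have hX : (X i : TropRatFun n) ≠ 0 := fun h => by
    have h1 := eval_X 0 i
    rw [h, map_zero] at h1
    exact TropReal.ofReal_ne_zero _ h1.symm
  have h10 : (1 : TropRatFun m) ≠ 0 := fun h => by
    have h1 := congrArg (eval 0) h
    rw [map_one, map_zero] at h1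
    exact one_ne_zero h1
  obtain ⟨f, hf⟩ := RingCon.mk'_surjective _ (ψ ((E V).mk' (X i)))
  by_cases hf0 : f = 0
  -- The image of the unit `X i` is a unit; if it is zero, then `0 = 1` in the quotient and `1`
  -- represents it too.
  · obtain ⟨g, hg⟩ := exists_mul_eq_one hX
    have h1 := congrArg (fun a => ψ ((E V).mk' a)) hg
    simp only [map_mul, map_one] at h1
    rw [← hf, hf0, map_zero, zero_mul] at h1
    refine ⟨1, h10, ?_⟩
    rw [← hf, hf0, map_one, map_zero, h1]
  · exact ⟨f, hf0, hf⟩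

theorem finitelyGenerated_of_algEquiv (e : (E V).Quotient ≃ₐ[TropReal] (E W).Quotient)
    (hW : (E W).FinitelyGenerated) : (E V).FinitelyGenerated := by
  choose f hf hψ using exists_ne_zero_mk'_eq (e : (E V).Quotient →ₐ[TropReal] (E W).Quotient)
  exact finitelyGenerated_of_injective _ f hf hψ e.injective hW

end TropRatFun

end TropicalCongruences

theorem corollary7 (n m : ℕ) (V : Set (Fin n → ℝ)) (W : Set (Fin m → ℝ)) :
    (∀ (ψ : (TropRatFun.E V).Quotient →ₐ[TropReal] (TropRatFun.E W).Quotient)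
        (f : Fin n → TropRatFun m) (hf : ∀ i, f i ≠ 0),
        (∀ i, (TropRatFun.E W).mk' (f i) = ψ ((TropRatFun.E V).mk' (TropRatFun.X i))) →
        Function.Injective ψ →
        IsClosed (TropRatFun.toMap f hf '' closure W) →
        (TropRatFun.E W).FinitelyGenerated →
        (TropRatFun.E V).FinitelyGenerated) ∧
    (Nonempty ((TropRatFun.E V).Quotient ≃ₐ[TropReal] (TropRatFun.E W).Quotient) →
      ((TropRatFun.E V).FinitelyGenerated ↔ (TropRatFun.E W).FinitelyGenerated)) :=
  ⟨fun ψ f hf hψ hinj _ hW => TropRatFun.finitelyGenerated_of_injective ψ f hf hψ hinj hW,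
    fun ⟨e⟩ => ⟨TropRatFun.finitelyGenerated_of_algEquiv e.symm,
      TropRatFun.finitelyGenerated_of_algEquiv e⟩⟩
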